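/- All graphs are finite and simple. For $\alpha\ge 0$ and a graph $G$ with adjacency matrix $A(G)$ and diagonal degree matrix $D(G)$, let $\Theta(G,\alpha)$ be the largest eigenvalue of $M_\alpha(G)=A(G)+\alpha D(G)$. A graph $G$ is called a $\Theta_\alpha$-maximal graph of a class $\mathcal G$ of graphs if $G\in\mathcal G$ and $\Theta(H,\alpha)\le\Theta(G,\alpha)$ for every $H\in\mathcal G$. For integers $t\ge 0$ and $n\ge t+2$, a $t$-cone tree on $n$ vertices is a join $K_t\vee T$, where $T$ is a tree with $n-t$ vertices ($K_0$ is the null graph). For a non-increasing integer sequence $\pi=(d_1,\dots,d_n)$, let $\Gamma(\pi,t;0)$ be the class of $t$-cone trees on $n$ vertices with degree sequence $\pi$. For non-increasing sequences $\pi=(d_1,\dots,d_n)$ and $\pi'=(d_1',\dots,d_n')$ we say that $\pi$ is strictly majorized by $\pi'$, written $\pi\lhd\pi'$, if $\pi\ne\pi'$, $\sum_{i=1}^k d_i\le\sum_{i=1}^k d_i'$ for $k=1,\dots,n-1$, and $\sum_{i=1}^n d_i=\sum_{i=1}^n d_i'$. Theorem. Let $\alpha\ge 0$ be a real number and let $n,t$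 be integers with $0\le t\le n-3$. Let $\pi$ and $\pi'$ be non-increasing degree sequences of $t$-cone trees on $n$ vertices with $\pi\lhd\pi'$. If $G_\pi$ is a $\Theta_\alpha$-maximal graph of $\Gamma(\pi,t;0)$ and $G_{\pi'}$ is a $\Theta_\alpha$-maximal graph of $\Gamma(\pi',t;0)$, then $$\Theta(G_\pi,\alpha)<\Theta(G_{\pi'},\alpha).$$ -/

import Mathlib

namespace ConeGraph

/-- `y` is majorized by `z`, for finite non-increasing sequences: every initial partial sum of `y` is
at most the corresponding one of `z`, and the total sums agree. -/
def Majorized {n : ℕ} (y z : Fin n → ℝ) : Prop :=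
  Antitone y ∧ Antitone z ∧
    (∀ k : ℕ, 1 ≤ k → k < n →
      (∑ i with i.val < k, y i) ≤ ∑ i with i.val < k, z i) ∧
    ∑ i, y i = ∑ i, z i

/-- Strict majorization `y ◁ z`. -/
def StrictlyMajorized {n : ℕ} (y z : Fin n → ℝ) : Prop :=
  Majorized y z ∧ y ≠ z

/-- The join `G ∨ H`: the disjoint union together with all edges between the two parts. -/
def join {V W : Type*} (G : SimpleGraph V) (H : SimpleGraph W) : SimpleGraph (V ⊕ W) :=
  SimpleGraph.sum G H ⊔ completeBipartiteGraph V W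

/-- A `c`-cyclic graph: connected, with `m = n + c - 1` edges on `n` vertices
(written without subtraction). -/
def IsCyclicGraph {V : Type*} (c : ℕ) (G : SimpleGraph V) : Prop :=
  G.Connected ∧ Nat.card G.edgeSet + 1 = Nat.card V + c

/-- A `t`-cone `c`-cyclic graph on `n` vertices: a graph isomorphic to `K_t ∨ H` for some `c`-cyclic
graph `H` on `n - t` vertices, where `t ≤ n - 2`. -/
def IsConeCyclicGraph {n : ℕ} (t c : ℕ) (G : SimpleGraph (Fin n)) : Prop :=
  t + 2 ≤ n ∧ ∃ H : SimpleGraph (Fin (n - t)), IsCyclicGraph c H ∧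
    Nonempty (G ≃g join (⊤ : SimpleGraph (Fin t)) H)

open Classical in
/-- `π` is the (non-increasing) degree sequence of `G`. -/
def HasDegreeSequence {n : ℕ} (G : SimpleGraph (Fin n)) (π : Fin n → ℕ) : Prop :=
  Antitone π ∧ ∃ v : Equiv.Perm (Fin n), ∀ i, G.degree (v i) = π i

/-- The class `Γ(π, t; c)` of `t`-cone `c`-cyclic graphs with degree sequence `π`. -/
def coneClass {n : ℕ} (π : Fin n → ℕ) (t c : ℕ) : Set (SimpleGraph (Fin n)) :=
  {G | IsConeCyclicGraph t c G ∧ HasDegreeSequence G π}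

open Classical in
/-- The general matrix `M_α(G) = A(G) + α D(G)`. -/
noncomputable def generalMatrix {V : Type*} [Fintype V] (G : SimpleGraph V) (α : ℝ) :
    Matrix V V ℝ :=
  G.adjMatrix ℝ + α • G.degMatrix ℝ

open Classical in
/-- The general spectral radius `Θ(G, α)`: the maximal eigenvalue of `M_α(G)`. For a graph with at
least one vertex the supremum is a maximum, see `isGreatest_generalSpectralRadius`. -/
noncomputable def generalSpectralRadius {V : Type*} [Fintype V] (G : SimpleGraph V) (α : ℝ) : ℝ :=
  sSup {μ : ℝ | Module.End.HasEigenvalue (Matrix.toLin' (generalMatrix G α)) μ}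

open Classical in
theorem isGreatest_generalSpectralRadius {V : Type*} [Fintype V] [Nonempty V]
    (G : SimpleGraph V) (α : ℝ) :
    IsGreatest {μ : ℝ | Module.End.HasEigenvalue (Matrix.toLin' (generalMatrix G α)) μ}
      (generalSpectralRadius G α) := by
  have hfin : {μ : ℝ | Module.End.HasEigenvalue
      (Matrix.toLin' (generalMatrix G α)) μ}.Finite :=
    Module.End.finite_hasEigenvalue _
  have hH : (generalMatrix G α).IsHermitian := by
    unfold generalMatrix SimpleGraph.degMatrix
    ext i j
    by_cases h : i = j
    · simp [h]
    · simp [h, Ne.symm h, SimpleGraph.adj_comm]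
  have hne : {μ : ℝ | Module.End.HasEigenvalue
      (Matrix.toLin' (generalMatrix G α)) μ}.Nonempty := by
    obtain ⟨i⟩ := ‹Nonempty V›
    refine ⟨hH.eigenvalues i, ?_⟩
    refine Module.End.hasEigenvalue_of_hasEigenvector (x := hH.eigenvectorBasis i) ?_
    refine ⟨?_, ?_⟩
    · rw [Module.End.mem_eigenspace_iff, Matrix.toLin'_apply]
      exact hH.mulVec_eigenvectorBasis i
    · intro h0
      exact hH.eigenvectorBasis.orthonormal.ne_zero i (by ext j; exact congrFun h0 j)
  exact ⟨hne.csSup_mem hfin, fun μ hμ => le_csSup hfin.bddAbove hμ⟩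

/-- `G` is a `Θ_α`-maximal graph of the class `𝒢`. -/
def IsThetaMaximal {V : Type*} [Fintype V] (α : ℝ) (𝒢 : Set (SimpleGraph V))
    (G : SimpleGraph V) : Prop :=
  G ∈ 𝒢 ∧ ∀ H ∈ 𝒢, generalSpectralRadius H α ≤ generalSpectralRadius G α

end ConeGraph

/-! Majorization is climbed by unit transfers. If `π ≠ π'` is majorized by `π'`, some unit can pass
from a later entry `j` to an earlier entry `i`, keeping the sequence non-increasing and majorized by
`π'` (`exists_unitTransfer`). It therefore suffices to realize one transfer by a cone tree of
strictly larger spectral radius (`exists_mem_coneClass_unitTransfer`).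

Let `p`, `q` carry the degrees `π i`, `π j`. The bound `π i < π' i ≤ n - 1` forces both into the
tree, and `π j > π' j > t` gives `q` tree degree at least 2. Take a positive eigenvector `x` of the
join. Moving edges towards the end of larger weight keeps a tree and does not lower the quadratic
form. If `x` is larger at `p`, one edge moves from `q` to `p`; otherwise so many edges move from `p`
to `q` that the two vertices exchange roles. Either way the degree multiset is the transferred one.
Strictness comes from one row of `M x` that grows (`generalSpectralRadius_lt_of_eigenvector`). -/

namespace ConeGraph

open Matrix

/-! ### Rayleigh quotients and Perron–Frobenius for `M_α` -/

section Spectral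

variable {V : Type*} [Fintype V]

open Classical in
theorem degree_eq_sum_ite (G : SimpleGraph V) (v : V) :
    (G.degree v) = ∑ u, if G.Adj v u then 1 else 0 := by
  rw [Finset.sum_boole, ← SimpleGraph.card_neighborFinset_eq_degree,
    SimpleGraph.neighborFinset_eq_filter]
  simp

open Classical in
theorem generalMatrix_mulVec_apply (G : SimpleGraph V) (α : ℝ) (x : V → ℝ) (v : V) :
    (generalMatrix G α *ᵥ x) v = ∑ u, if G.Adj v u then x u + α * x v else 0 := by
  have h1 : ∀ u, (if G.Adj v u then x u + α * x v else 0)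
      = (if G.Adj v u then 1 else 0) * x u + (if G.Adj v u then (1 : ℝ) else 0) * (α * x v) := by
    intro u; split_ifs <;> ring
  have h2 : (G.degree v : ℝ) = ∑ u, if G.Adj v u then (1 : ℝ) else 0 := by
    rw [degree_eq_sum_ite]; push_cast; rfl
  simp only [h1, Finset.sum_add_distrib, ← Finset.sum_mul, ← h2]
  unfold generalMatrix SimpleGraph.degMatrix
  rw [Matrix.add_mulVec, Matrix.smul_mulVec, Pi.add_apply, Pi.smul_apply,
    Matrix.mulVec_diagonal]
  congr 1
  rw [smul_eq_mul]; ring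

open Classical in
theorem isHermitian_generalMatrix (G : SimpleGraph V) (α : ℝ) : (generalMatrix G α).IsHermitian := by
  unfold generalMatrix SimpleGraph.degMatrix
  ext i j
  by_cases h : i = j
  · simp [h]
  · simp [h, Ne.symm h, SimpleGraph.adj_comm]

theorem hasEigenvalue_iff_exists_mulVec (G : SimpleGraph V) (α μ : ℝ) :
    (open Classical in Module.End.HasEigenvalue (Matrix.toLin' (generalMatrix G α)) μ) ↔
      ∃ x : V → ℝ, x ≠ 0 ∧ generalMatrix G α *ᵥ x = μ • x := by
  classical
  constructor
  · intro h
    obtain ⟨x, hx⟩ := h.exists_hasEigenvector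
    refine ⟨x, hx.2, ?_⟩
    have := hx.apply_eq_smul
    rwa [Matrix.toLin'_apply'] at this
  · rintro ⟨x, hx, h⟩
    refine Module.End.hasEigenvalue_of_hasEigenvector (x := x) ⟨?_, hx⟩
    rw [Module.End.mem_eigenspace_iff, Matrix.toLin'_apply']
    exact h

theorem exists_eigenvector_of_iso {W : Type*} [Fintype W] {G : SimpleGraph V} {H : SimpleGraph W}
    (φ : G ≃g H) {α μ : ℝ} (h : ∃ x : W → ℝ, x ≠ 0 ∧ generalMatrix H α *ᵥ x = μ • x) :
    ∃ x : V → ℝ, x ≠ 0 ∧ generalMatrix G α *ᵥ x = μ • x := by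
  classical
  obtain ⟨x, hx, h⟩ := h
  refine ⟨x ∘ φ, ?_, ?_⟩
  · intro h0
    apply hx
    ext w
    simpa using congrFun h0 (φ.symm w)
  · ext v
    have := congrFun h (φ v)
    rw [generalMatrix_mulVec_apply] at this ⊢
    rw [← Equiv.sum_comp φ.toEquiv] at this
    simpa [φ.map_adj_iff] using this

theorem generalSpectralRadius_congr {W : Type*} [Fintype W] {G : SimpleGraph V} {H : SimpleGraph W}
    (φ : G ≃g H) (α : ℝ) : generalSpectralRadius G α = generalSpectralRadius H α := by
  unfold generalSpectralRadius
  congr 1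
  ext μ
  rw [Set.mem_ofPred_eq, Set.mem_ofPred_eq, hasEigenvalue_iff_exists_mulVec,
    hasEigenvalue_iff_exists_mulVec]
  exact ⟨exists_eigenvector_of_iso φ.symm, exists_eigenvector_of_iso φ⟩

open Classical in
theorem posSemidef_generalSpectralRadius_sub [Nonempty V] (G : SimpleGraph V) (α : ℝ) :
    (generalSpectralRadius G α • (1 : Matrix V V ℝ) - generalMatrix G α).PosSemidef := by
  have hH : (generalSpectralRadius G α • (1 : Matrix V V ℝ) - generalMatrix G α).IsHermitian := by
    refine Matrix.IsHermitian.sub ?_ (isHermitian_generalMatrix G α)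
    ext i j
    by_cases h : i = j
    · simp [h]
    · simp [h, Ne.symm h]
  rw [hH.posSemidef_iff_eigenvalues_nonneg]
  intro i
  have h := hH.mulVec_eigenvectorBasis i
  set x := (hH.eigenvectorBasis i).ofLp with hx
  have hx0 : x ≠ 0 := by
    intro h0
    exact hH.eigenvectorBasis.orthonormal.ne_zero i (by ext j; exact congrFun h0 j)
  have hle := (isGreatest_generalSpectralRadius G α).2
    ((hasEigenvalue_iff_exists_mulVec G α
      (generalSpectralRadius G α - hH.eigenvalues i)).2 ⟨x, hx0, by
        rw [Matrix.sub_mulVec, Matrix.smul_mulVec, Matrix.one_mulVec] at h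
        rw [sub_smul, ← h]; abel⟩)
  simp only [Pi.zero_apply]
  linarith

theorem dotProduct_generalMatrix_mulVec_le [Nonempty V] (G : SimpleGraph V) (α : ℝ) (x : V → ℝ) :
    x ⬝ᵥ (generalMatrix G α *ᵥ x) ≤ generalSpectralRadius G α * (x ⬝ᵥ x) := by
  classical
  have := (posSemidef_generalSpectralRadius_sub G α).dotProduct_mulVec_nonneg x
  rw [Matrix.sub_mulVec, Matrix.smul_mulVec, Matrix.one_mulVec, dotProduct_sub, dotProduct_smul,
    star_trivial, smul_eq_mul] at this
  linarith

/-- A positive semidefinite form vanishes only on the kernel of its matrix, so Rayleigh maximizers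
are eigenvectors. -/
theorem mulVec_eq_smul_of_dotProduct_eq [Nonempty V] (G : SimpleGraph V) (α : ℝ) (x : V → ℝ)
    (h : x ⬝ᵥ (generalMatrix G α *ᵥ x) = generalSpectralRadius G α * (x ⬝ᵥ x)) :
    generalMatrix G α *ᵥ x = generalSpectralRadius G α • x := by
  classical
  have := ((posSemidef_generalSpectralRadius_sub G α).dotProduct_mulVec_zero_iff x).1 (by
    rw [Matrix.sub_mulVec, Matrix.smul_mulVec, Matrix.one_mulVec, dotProduct_sub, dotProduct_smul,
      star_trivial, smul_eq_mul, h, sub_self])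
  rw [Matrix.sub_mulVec, Matrix.smul_mulVec, Matrix.one_mulVec, sub_eq_zero] at this
  exact this.symm

/-- A connected graph has a positive eigenvector for its general spectral radius. -/
theorem exists_pos_eigenvector [Nonempty V] {G : SimpleGraph V} (hG : G.Preconnected) {α : ℝ}
    (hα : 0 ≤ α) :
    ∃ x : V → ℝ, (∀ v, 0 < x v) ∧
      generalMatrix G α *ᵥ x = generalSpectralRadius G α • x := by
  classical
  obtain ⟨y, hy0, hy⟩ := (hasEigenvalue_iff_exists_mulVec G α _).1
    (isGreatest_generalSpectralRadius G α).1
  set x : V → ℝ := fun v => |y v| with hx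
  have hxx : x ⬝ᵥ x = y ⬝ᵥ y := by simp [dotProduct, hx]
  have hle : y ⬝ᵥ (generalMatrix G α *ᵥ y) ≤ x ⬝ᵥ (generalMatrix G α *ᵥ x) := by
    simp only [dotProduct, generalMatrix_mulVec_apply, Finset.mul_sum]
    refine Finset.sum_le_sum fun v _ => Finset.sum_le_sum fun u _ => ?_
    split_ifs
    · have h1 : y v * y u ≤ |y v| * |y u| := by rw [← abs_mul]; exact le_abs_self _
      have h2 : |y v| * |y v| = y v * y v := abs_mul_abs_self _
      simp only [hx]
      nlinarith
    · simp
  -- The entrywise absolute value has the same norm and no smaller form, so it attains the Rayleigh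
  -- maximum too.
  have hev : generalMatrix G α *ᵥ x = generalSpectralRadius G α • x := by
    refine mulVec_eq_smul_of_dotProduct_eq G α x
      (le_antisymm (dotProduct_generalMatrix_mulVec_le G α x) ?_)
    rwa [hxx, ← smul_eq_mul, ← dotProduct_smul, ← hy]
  refine ⟨x, ?_, hev⟩
  have hnn : ∀ v, 0 ≤ x v := fun v => abs_nonneg _
  -- At a zero of `x` the row equation is a vanishing sum of nonnegative terms, so zeros spread to
  -- neighbours.
  have hstep : ∀ v u, G.Adj v u → x v = 0 → x u = 0 := by
    intro v u hvu hv
    have h := congrFun hev v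
    rw [generalMatrix_mulVec_apply, Pi.smul_apply, hv, smul_zero,
      Finset.sum_eq_zero_iff_of_nonneg] at h
    · simpa [hvu] using h u (Finset.mem_univ u)
    · intro w _
      split_ifs
      · simpa using hnn w
      · exact le_rfl
  have hwalk : ∀ v u, G.Walk v u → x v = 0 → x u = 0 := by
    intro v u p
    induction p with
    | nil => exact id
    | cons h _ ih => exact fun h0 => ih (hstep _ _ h h0)
  intro v
  refine lt_of_le_of_ne (hnn v) fun h0 => hy0 ?_
  ext u
  obtain ⟨p⟩ := hG v u
  exact abs_eq_zero.1 (hwalk v u p h0.symm)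

/-- If the radii agreed, `x` would be a Rayleigh maximizer for `H`, hence an eigenvector with the
same eigenvalue, and row `a` could not differ. So a weak increase of the form is enough. -/
theorem generalSpectralRadius_lt_of_eigenvector [Nonempty V] {G H : SimpleGraph V} {α : ℝ}
    {x : V → ℝ} (hx : generalMatrix G α *ᵥ x = generalSpectralRadius G α • x) {a : V}
    (hxa : 0 < x a)
    (hle : x ⬝ᵥ (generalMatrix G α *ᵥ x) ≤ x ⬝ᵥ (generalMatrix H α *ᵥ x))
    (hlt : (generalMatrix G α *ᵥ x) a < (generalMatrix H α *ᵥ x) a) :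
    generalSpectralRadius G α < generalSpectralRadius H α := by
  have hpos : 0 < x ⬝ᵥ x := by
    refine Finset.sum_pos' (fun v _ => mul_self_nonneg _) ⟨a, Finset.mem_univ a, by positivity⟩
  have h1 := dotProduct_generalMatrix_mulVec_le H α x
  have h2 : x ⬝ᵥ (generalMatrix G α *ᵥ x) = generalSpectralRadius G α * (x ⬝ᵥ x) := by
    rw [hx, dotProduct_smul, smul_eq_mul]
  have h3 : generalSpectralRadius G α ≤ generalSpectralRadius H α :=
    le_of_mul_le_mul_right (by linarith) hpos
  refine lt_of_le_of_ne h3 fun heq => hlt.ne ?_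
  rw [hx, mulVec_eq_smul_of_dotProduct_eq H α x (le_antisymm h1 (by rw [← heq]; linarith)), heq]

end Spectral

/-! ### Moving edges between two vertices of a tree -/

section Move

variable {V : Type*}

/-- The graph obtained from `T` by replacing the edge `b w` by the edge `a w`. -/
def moveEdge (T : SimpleGraph V) (a b w : V) : SimpleGraph V :=
  T.deleteEdges {s(b, w)} ⊔ SimpleGraph.edge a w

theorem moveEdge_adj (T : SimpleGraph V) (a b w u v : V) :
    (moveEdge T a b w).Adj u v ↔ (T.Adj u v ∧ ¬ (u = b ∧ v = w) ∧ ¬ (u = w ∧ v = b)) ∨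
      ((u = a ∧ v = w) ∨ (u = w ∧ v = a)) ∧ u ≠ v := by
  simp only [moveEdge, SimpleGraph.sup_adj, SimpleGraph.deleteEdges_adj, Set.mem_singleton_iff,
    SimpleGraph.edge_adj, Sym2.eq_iff]
  tauto

open Classical in
-- Keeping `g` arbitrary lets one identity serve both degrees (`g = 1`) and the action of `M_α`.
theorem moveEdge_ite {T : SimpleGraph V} {a b w : V} (hab : a ≠ b) (haw : a ≠ w)
    (hbw : T.Adj b w) (hn : ¬ T.Adj a w) (g : V → V → ℝ) (v u : V) :
    (if (moveEdge T a b w).Adj v u then g v u else 0) = (if T.Adj v u then g v u else 0)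
      + (if v = a then if u = w then g a w else 0 else 0)
      + (if v = w then if u = a then g w a else 0 else 0)
      - (if v = b then if u = w then g b w else 0 else 0)
      - (if v = w then if u = b then g w b else 0 else 0) := by
  have hbw' := hbw.ne
  have h1 := hbw.symm
  have h2 : ¬ T.Adj w a := fun h => hn h.symm
  rw [if_congr (moveEdge_adj T a b w v u) rfl rfl]
  by_cases hva : v = a <;> by_cases hvb : v = b <;> by_cases hvw : v = w <;>
    by_cases hua : u = a <;> by_cases hub : u = b <;> by_cases huw : u = w <;>
    simp_all

variable [Fintype V]

open Classical in
theorem sum_moveEdge_ite {T : SimpleGraph V} {a b w : V} (hab : a ≠ b) (haw : a ≠ w)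
    (hbw : T.Adj b w) (hn : ¬ T.Adj a w) (g : V → V → ℝ) (v : V) :
    (∑ u, if (moveEdge T a b w).Adj v u then g v u else 0) = (∑ u, if T.Adj v u then g v u else 0)
      + (if v = a then g a w else 0) + (if v = w then g w a else 0)
      - (if v = b then g b w else 0) - (if v = w then g w b else 0) := by
  simp only [moveEdge_ite hab haw hbw hn g v, Finset.sum_sub_distrib, Finset.sum_add_distrib]
  congr 1
  · congr 1
    · congr 1
      · congr 1
        split_ifs <;> simp
      · split_ifs <;> simp
    · split_ifs <;> simp
  · split_ifs <;> simp

open Classical in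
theorem degree_moveEdge {T : SimpleGraph V} {a b w : V} (hab : a ≠ b) (haw : a ≠ w)
    (hbw : T.Adj b w) (hn : ¬ T.Adj a w) (v : V) :
    ((moveEdge T a b w).degree v : ℝ) =
      T.degree v + (if v = a then 1 else 0) - (if v = b then 1 else 0) := by
  have h := sum_moveEdge_ite hab haw hbw hn (fun _ _ => 1) v
  rw [degree_eq_sum_ite, degree_eq_sum_ite]
  push_cast
  linarith

theorem generalMatrix_moveEdge_mulVec {T : SimpleGraph V} {a b w : V} (hab : a ≠ b)
    (haw : a ≠ w) (hbw : T.Adj b w) (hn : ¬ T.Adj a w) (α : ℝ) (x : V → ℝ) (v : V) :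
    (generalMatrix (moveEdge T a b w) α *ᵥ x) v = (generalMatrix T α *ᵥ x) v
      + (open Classical in (if v = a then x w + α * x a else 0)
      + (if v = w then x a - x b else 0)
      - (if v = b then x w + α * x b else 0)) := by
  classical
  rw [generalMatrix_mulVec_apply, generalMatrix_mulVec_apply,
    sum_moveEdge_ite hab haw hbw hn (fun v u => x u + α * x v) v]
  split_ifs <;> ring

theorem dotProduct_generalMatrix_moveEdge {T : SimpleGraph V} {a b w : V} (hab : a ≠ b)
    (haw : a ≠ w) (hbw : T.Adj b w) (hn : ¬ T.Adj a w) (α : ℝ) (x : V → ℝ) :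
    x ⬝ᵥ (generalMatrix (moveEdge T a b w) α *ᵥ x) = x ⬝ᵥ (generalMatrix T α *ᵥ x)
      + 2 * x w * (x a - x b) + α * (x a ^ 2 - x b ^ 2) := by
  classical
  have : generalMatrix (moveEdge T a b w) α *ᵥ x = generalMatrix T α *ᵥ x
      + (Pi.single a (x w + α * x a) + Pi.single w (x a - x b) - Pi.single b (x w + α * x b)) := by
    ext v
    rw [generalMatrix_moveEdge_mulVec hab haw hbw hn]
    simp [Pi.single_apply]
  rw [this]
  simp only [dotProduct_add, dotProduct_sub, dotProduct_single]
  ring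

/-- In a tree, an edge at `b` avoiding the path to `a` can be moved from `b` to `a`. -/
theorem exists_isTree_moveEdge {T : SimpleGraph V} (hT : T.IsTree) {a b : V} (hab : a ≠ b)
    (hb : open Classical in 2 ≤ T.degree b) :
    ∃ w, a ≠ w ∧ T.Adj b w ∧ ¬ T.Adj a w ∧ (moveEdge T a b w).IsTree := by
  classical
  -- `w` is a neighbour of `b` off the path to `a`, so that path survives the deletion of `b w`.
  obtain ⟨w, hbw, hreach⟩ : ∃ w, T.Adj b w ∧ (T.deleteEdges {s(b, w)}).Reachable b a := by
    obtain ⟨p, hp⟩ := (hT.existsUnique_path b a).exists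
    cases p with
    | nil => exact absurd rfl hab
    | @cons _ s _ h p =>
      rw [SimpleGraph.Walk.cons_isPath_iff] at hp
      have : 1 < (T.neighborFinset b).card := by
        rw [SimpleGraph.card_neighborFinset_eq_degree]; omega
      obtain ⟨w, hw, hws⟩ := Finset.exists_mem_ne this s
      rw [SimpleGraph.mem_neighborFinset] at hw
      refine ⟨w, hw, ⟨(SimpleGraph.Walk.cons h p).toDeleteEdges _ ?_⟩⟩
      intro e he hbad
      rw [Set.mem_singleton_iff] at hbad
      subst hbad
      rw [SimpleGraph.Walk.edges_cons, List.mem_cons] at he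
      rcases he with he | he
      · rw [Sym2.congr_right] at he
        exact hws he
      · exact hp.2 (p.fst_mem_support_of_mem_edges he)
  -- Every tree edge is a bridge; as `a` stays on the side of `b`, it is neither `w` nor adjacent to
  -- `w`.
  have hbridge : ¬ (T.deleteEdges {s(b, w)}).Reachable b w :=
    SimpleGraph.isBridge_iff.1 (SimpleGraph.isAcyclic_iff_forall_adj_isBridge.1 hT.isAcyclic hbw)
  have haw : a ≠ w := by
    rintro rfl
    exact hbridge hreach
  have hn : ¬ T.Adj a w := by
    intro h
    refine hbridge (hreach.trans (SimpleGraph.Adj.reachable ?_))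
    rw [SimpleGraph.deleteEdges_adj]
    refine ⟨h, ?_⟩
    rw [Set.mem_singleton_iff, Sym2.congr_left]
    exact hab
  refine ⟨w, haw, hbw, hn, ?_⟩
  have hle : T.deleteEdges {s(b, w)} ≤ moveEdge T a b w := le_sup_left
  have hbw' : (moveEdge T a b w).Reachable b w := by
    refine (hreach.mono hle).trans (SimpleGraph.Adj.reachable ?_)
    rw [moveEdge_adj]
    exact Or.inr ⟨Or.inl ⟨rfl, rfl⟩, haw⟩
  have hadj : ∀ u v, T.Adj u v → (moveEdge T a b w).Reachable u v := by
    intro u v huv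
    by_cases h1 : u = b ∧ v = w
    · rw [h1.1, h1.2]; exact hbw'
    by_cases h2 : u = w ∧ v = b
    · rw [h2.1, h2.2]; exact hbw'.symm
    · exact SimpleGraph.Adj.reachable ((moveEdge_adj _ _ _ _ _ _).2 (Or.inl ⟨huv, h1, h2⟩))
  have hwalk : ∀ u v, T.Walk u v → (moveEdge T a b w).Reachable u v := by
    intro u v p
    induction p with
    | nil => exact SimpleGraph.Reachable.refl _
    | cons h _ ih => exact (hadj _ _ h).trans ih
  rw [SimpleGraph.isTree_iff_connected_and_card] at hT ⊢
  have := hT.1.nonempty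
  refine ⟨⟨fun u v => (hT.1.preconnected u v).elim fun p => hwalk u v p⟩, ?_⟩
  rw [← hT.2]
  congr 1
  -- The degree sum is unchanged, so by the handshake lemma the number of edges is too.
  have h1 := T.sum_degrees_eq_twice_card_edges
  have h2 := (moveEdge T a b w).sum_degrees_eq_twice_card_edges
  have h3 : ((∑ v, (moveEdge T a b w).degree v : ℕ) : ℝ) = (∑ v, T.degree v : ℕ) := by
    push_cast
    simp only [degree_moveEdge hab haw hbw hn, Finset.sum_sub_distrib, Finset.sum_add_distrib]
    simp
  rw [h1, h2] at h3
  have h4 := Nat.cast_injective h3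
  rw [Nat.card_eq_fintype_card, Nat.card_eq_fintype_card, ← SimpleGraph.edgeFinset_card,
    ← SimpleGraph.edgeFinset_card]
  omega

open Classical in
/-- In a tree, `k < deg b` edges can be moved from `b` to a vertex `a` of no smaller weight so that
the quadratic form of the general matrix does not decrease. -/
theorem exists_isTree_move_edges {T : SimpleGraph V} (hT : T.IsTree) {a b : V} (hab : a ≠ b)
    {α : ℝ} (hα : 0 ≤ α) {x : V → ℝ} (hx : ∀ v, 0 < x v) (hxab : x b ≤ x a) (k : ℕ)
    (hk : k < T.degree b) :
    ∃ T' : SimpleGraph V, T'.IsTree ∧ T'.degree a = T.degree a + k ∧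
      T'.degree b + k = T.degree b ∧ (∀ v, v ≠ a → v ≠ b → T'.degree v = T.degree v) ∧
      x ⬝ᵥ (generalMatrix T α *ᵥ x) ≤ x ⬝ᵥ (generalMatrix T' α *ᵥ x) ∧
      (generalMatrix T α *ᵥ x) a ≤ (generalMatrix T' α *ᵥ x) a ∧
      (0 < k → (generalMatrix T α *ᵥ x) a < (generalMatrix T' α *ᵥ x) a) := by
  induction k with
  | zero => exact ⟨T, hT, rfl, rfl, fun _ _ _ => rfl, le_rfl, le_rfl, fun h => absurd h (by simp)⟩
  | succ k ih =>
    obtain ⟨T₁, hT₁, ha, hb, hv, hq, hle, -⟩ := ih (by omega)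
    obtain ⟨w, haw, hbw, hn, hT₂⟩ := exists_isTree_moveEdge hT₁ hab (by omega)
    have hdeg := degree_moveEdge hab haw hbw hn
    have hlt : (generalMatrix T α *ᵥ x) a < (generalMatrix (moveEdge T₁ a b w) α *ᵥ x) a := by
      rw [generalMatrix_moveEdge_mulVec hab haw hbw hn, if_pos rfl, if_neg haw, if_neg hab]
      have := hx w
      have := mul_nonneg hα (hx a).le
      linarith
    refine ⟨_, hT₂, ?_, ?_, ?_, ?_, hlt.le, fun _ => hlt⟩
    · have h := hdeg a
      rw [if_pos rfl, if_neg hab, ha, sub_zero] at h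
      exact_mod_cast h
    · have h := hdeg b
      rw [if_neg hab.symm, if_pos rfl, ← sub_eq_zero] at h
      have h' : (((moveEdge T₁ a b w).degree b + 1 : ℕ) : ℝ) = T₁.degree b := by
        push_cast; linarith
      have := Nat.cast_injective h'
      omega
    · intro v hva hvb
      have h := hdeg v
      rw [if_neg hva, if_neg hvb, add_zero, sub_zero, hv v hva hvb] at h
      exact_mod_cast h
    · rw [dotProduct_generalMatrix_moveEdge hab haw hbw hn]
      have h1 : 0 ≤ 2 * x w * (x a - x b) :=
        mul_nonneg (by have := hx w; positivity) (by linarith)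
      have h2 : 0 ≤ α * (x a ^ 2 - x b ^ 2) :=
        mul_nonneg hα (by nlinarith [hx a, hx b])
      linarith

end Move

/-! ### Joins, and the comparison for one transfer -/

section Join

variable {V W : Type*} (K : SimpleGraph V) (H : SimpleGraph W)

@[simp] theorem join_adj_inl_inl (u v : V) :
    (join K H).Adj (Sum.inl u) (Sum.inl v) ↔ K.Adj u v := by simp [join]

@[simp] theorem join_adj_inr_inr (u v : W) :
    (join K H).Adj (Sum.inr u) (Sum.inr v) ↔ H.Adj u v := by simp [join]

@[simp] theorem join_adj_inl_inr (u : V) (v : W) :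
    (join K H).Adj (Sum.inl u) (Sum.inr v) := by simp [join]

@[simp] theorem join_adj_inr_inl (u : W) (v : V) :
    (join K H).Adj (Sum.inr u) (Sum.inl v) := by simp [join]

theorem join_preconnected {H : SimpleGraph W} (hH : H.Connected) : (join K H).Preconnected := by
  obtain ⟨w₀⟩ := hH.nonempty
  have h : ∀ z, (join K H).Reachable z (Sum.inr w₀) := by
    rintro (v | w)
    · exact (join_adj_inl_inr K H v w₀).reachable
    · exact (hH.preconnected w w₀).map ⟨Sum.inr, fun h => (join_adj_inr_inr K H _ _).2 h⟩
  exact fun y z => (h y).trans (h z).symm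

variable [Fintype V] [Fintype W]

open Classical in
theorem degree_join_inl (v : V) :
    (join K H).degree (Sum.inl v) = K.degree v + Fintype.card W := by
  simp only [degree_eq_sum_ite, Fintype.sum_sum_type, join_adj_inl_inl, join_adj_inl_inr, if_true,
    Finset.sum_const, Finset.card_univ, smul_eq_mul, mul_one]

open Classical in
theorem degree_join_inr (w : W) :
    (join K H).degree (Sum.inr w) = Fintype.card V + H.degree w := by
  simp only [degree_eq_sum_ite, Fintype.sum_sum_type, join_adj_inr_inr, join_adj_inr_inl, if_true,
    Finset.sum_const, Finset.card_univ, smul_eq_mul, mul_one]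

open Classical in
theorem generalMatrix_join_mulVec_inl (α : ℝ) (x : V ⊕ W → ℝ) (v : V) :
    (generalMatrix (join K H) α *ᵥ x) (Sum.inl v) =
      (generalMatrix K α *ᵥ (x ∘ Sum.inl)) v + ∑ w, (x (Sum.inr w) + α * x (Sum.inl v)) := by
  simp [generalMatrix_mulVec_apply]

open Classical in
theorem generalMatrix_join_mulVec_inr (α : ℝ) (x : V ⊕ W → ℝ) (w : W) :
    (generalMatrix (join K H) α *ᵥ x) (Sum.inr w) =
      ∑ v, (x (Sum.inl v) + α * x (Sum.inr w)) + (generalMatrix H α *ᵥ (x ∘ Sum.inr)) w := by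
  simp [generalMatrix_mulVec_apply]

/-- The terms coming from `K` and from the edges across do not depend on `H`. -/
theorem dotProduct_generalMatrix_join_le {H H' : SimpleGraph W} {α : ℝ} {x : V ⊕ W → ℝ}
    (h : (x ∘ Sum.inr) ⬝ᵥ (generalMatrix H α *ᵥ (x ∘ Sum.inr)) ≤
      (x ∘ Sum.inr) ⬝ᵥ (generalMatrix H' α *ᵥ (x ∘ Sum.inr))) :
    x ⬝ᵥ (generalMatrix (join K H) α *ᵥ x) ≤ x ⬝ᵥ (generalMatrix (join K H') α *ᵥ x) := by
  simp only [dotProduct, Fintype.sum_sum_type, generalMatrix_join_mulVec_inl,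
    generalMatrix_join_mulVec_inr, mul_add, Finset.sum_add_distrib] at h ⊢
  simp only [Function.comp_apply] at h
  linarith

open Classical in
/-- Moving edges of a tree `T` from `q` to `p` or from `p` to `q` raises the larger of the degrees
of `p` and `q` by one, lowers the other one, and increases the general spectral radius of `K ∨ T`. -/
theorem exists_isTree_generalSpectralRadius_join_lt {T : SimpleGraph W} (hT : T.IsTree)
    {p q : W} (hpq : p ≠ q) (hdeg : T.degree q ≤ T.degree p) (hq : 2 ≤ T.degree q) {α : ℝ}
    (hα : 0 ≤ α) :
    ∃ T' : SimpleGraph W, T'.IsTree ∧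
      generalSpectralRadius (join K T) α < generalSpectralRadius (join K T') α ∧
      (∀ v, v ≠ p → v ≠ q → T'.degree v = T.degree v) ∧
      ((T'.degree p = T.degree p + 1 ∧ T'.degree q + 1 = T.degree q) ∨
        (T'.degree q = T.degree p + 1 ∧ T'.degree p + 1 = T.degree q)) := by
  have : Nonempty (V ⊕ W) := ⟨Sum.inr p⟩
  obtain ⟨x, hx, hev⟩ := exists_pos_eigenvector (join_preconnected K hT.connected) hα
  have key : ∀ a b : W, a ≠ b → x (Sum.inr b) ≤ x (Sum.inr a) → ∀ k, 0 < k → k < T.degree b →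
      ∃ T' : SimpleGraph W, T'.IsTree ∧
        generalSpectralRadius (join K T) α < generalSpectralRadius (join K T') α ∧
        T'.degree a = T.degree a + k ∧ T'.degree b + k = T.degree b ∧
        ∀ v, v ≠ a → v ≠ b → T'.degree v = T.degree v := by
    intro a b hab hxab k hk0 hk
    obtain ⟨T', hT', ha, hb, hv, hle, -, hlt⟩ :=
      exists_isTree_move_edges hT hab hα (x := x ∘ Sum.inr) (fun v => hx _) hxab k hk
    refine ⟨T', hT', ?_, ha, hb, hv⟩
    refine generalSpectralRadius_lt_of_eigenvector hev (hx (Sum.inr a))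
      (dotProduct_generalMatrix_join_le K hle) ?_
    rw [generalMatrix_join_mulVec_inr, generalMatrix_join_mulVec_inr]
    have := hlt hk0
    linarith
  rcases le_total (x (Sum.inr q)) (x (Sum.inr p)) with h | h
  · obtain ⟨T', hT', hlt, ha, hb, hv⟩ := key p q hpq h 1 one_pos (by omega)
    exact ⟨T', hT', hlt, hv, Or.inl ⟨ha, hb⟩⟩
  -- This count gives `q` the degree `deg p + 1` and leaves `p` with `deg q - 1`; it is below `deg
  -- p` because `deg q ≥ 2`.
  · obtain ⟨T', hT', hlt, ha, hb, hv⟩ := key q p hpq.symm h (T.degree p + 1 - T.degree q)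
      (by omega) (by omega)
    exact ⟨T', hT', hlt, fun v h1 h2 => hv v h2 h1, Or.inr ⟨by omega, by omega⟩⟩

end Join

/-! ### Unit transfers between majorized sequences -/

section Majorization

variable {n : ℕ}

/-- The sum of the first `k` entries of a finite sequence. -/
def partialSum (a : Fin n → ℕ) (k : ℕ) : ℕ := ∑ i with i.val < k, a i

theorem partialSum_succ (a : Fin n → ℕ) (i : Fin n) :
    partialSum a (i.val + 1) = partialSum a i.val + a i := by
  unfold partialSum
  have : (Finset.univ.filter fun j : Fin n => j.val < i.val + 1)
      = insert i (Finset.univ.filter fun j : Fin n => j.val < i.val) := by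
    ext j
    simp only [Finset.mem_filter, Finset.mem_univ, true_and, Finset.mem_insert, Fin.ext_iff]
    omega
  rw [this, Finset.sum_insert (by simp), add_comm]

theorem partialSum_card (a : Fin n → ℕ) : partialSum a n = ∑ i, a i := by
  unfold partialSum
  rw [Finset.filter_true_of_mem fun i _ => i.isLt]

theorem partialSum_zero (a : Fin n → ℕ) : partialSum a 0 = 0 := by simp [partialSum]

/-- Moving one unit from the entry `j` to the entry `i`. -/
def unitTransfer (a : Fin n → ℕ) (i j : Fin n) : Fin n → ℕ :=
  fun k => if k = i then a k + 1 else if k = j then a k - 1 else a k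

theorem partialSum_unitTransfer (a : Fin n → ℕ) {i j : Fin n} (hij : i < j) (hj : 0 < a j) :
    ∀ k ≤ n, partialSum (unitTransfer a i j) k =
      partialSum a k + if i.val < k ∧ k ≤ j.val then 1 else 0 := by
  intro k
  rw [Fin.lt_def] at hij
  induction k with
  | zero => simp [partialSum_zero]
  | succ k ih =>
    intro hk
    have h1 := partialSum_succ (unitTransfer a i j) ⟨k, hk⟩
    have h2 := partialSum_succ a ⟨k, hk⟩
    simp only at h1 h2
    rw [h1, h2, ih (by omega)]
    simp only [unitTransfer, Fin.ext_iff]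
    have e : ∀ l : Fin n, k = l.val → a ⟨k, hk⟩ = a l := fun l h => by simp [h]
    have := e j
    split_ifs <;> omega

/-- A non-increasing sequence distinct from one that majorizes it admits a unit transfer that
keeps it non-increasing and majorized. -/
theorem exists_unitTransfer {a b : Fin n → ℕ} (ha : Antitone a) (hb : Antitone b)
    (hle : ∀ k ≤ n, partialSum a k ≤ partialSum b k) (htot : partialSum a n = partialSum b n)
    (hne : a ≠ b) :
    ∃ i j : Fin n, i < j ∧ a i < b i ∧ b j < a j ∧ Antitone (unitTransfer a i j) ∧
      ∀ k ≤ n, partialSum (unitTransfer a i j) k ≤ partialSum b k := by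
  classical
  -- `i` will be the first index where the sequences differ.
  have hex : ∃ k, ∃ h : k < n, a ⟨k, h⟩ ≠ b ⟨k, h⟩ := by
    by_contra! h
    exact hne (funext fun i => h i.1 i.2)
  obtain ⟨hin, hi⟩ := Nat.find_spec hex
  set i : Fin n := ⟨Nat.find hex, hin⟩ with hidef
  have hmin : ∀ k : Fin n, k < i → a k = b k := by
    intro k hk
    by_contra h
    exact Nat.find_min hex (Fin.lt_def.1 hk) ⟨k.2, h⟩
  have heq : partialSum a i.val = partialSum b i.val := by
    refine Finset.sum_congr rfl fun k hk => hmin k ?_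
    exact Fin.lt_def.2 (Finset.mem_filter.1 hk).2
  have hilt : a i < b i := by
    have := hle (i.val + 1) i.2
    rw [partialSum_succ, partialSum_succ] at this
    have : a i ≠ b i := hi
    omega
  -- `j` will be the first index after `i` through which the partial sums agree again; strictly
  -- between, there is room for one more unit.
  have hex2 : ∃ m, i.val + 1 ≤ m ∧ m < n ∧ partialSum a (m + 1) = partialSum b (m + 1) := by
    refine ⟨n - 1, ?_, by omega, by rw [Nat.sub_add_cancel (by omega)]; exact htot⟩
    by_contra h
    have h1 : i.val + 1 = n := by omega
    have h2 := partialSum_succ a i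
    have h3 := partialSum_succ b i
    rw [h1] at h2 h3
    omega
  obtain ⟨hij, hjn, hj⟩ := Nat.find_spec hex2
  set j : Fin n := ⟨Nat.find hex2, hjn⟩ with hjdef
  have hstrict : ∀ k, i.val < k → k ≤ j.val → partialSum a k < partialSum b k := by
    intro k hk hkj
    refine lt_of_le_of_ne (hle k (by omega)) fun h => ?_
    rcases Nat.lt_or_ge (i.val + 1) k with h1 | h1
    · refine Nat.find_min hex2 (m := k - 1) ?_ ⟨by omega, by omega, ?_⟩
      · have : j.val = Nat.find hex2 := rfl
        omega
      · rwa [Nat.sub_add_cancel (by omega)]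
    · obtain rfl : k = i.val + 1 := by omega
      rw [partialSum_succ, partialSum_succ] at h
      omega
  have hij' : i < j := hij
  have hjlt : b j < a j := by
    have h1 := hstrict j.val hij le_rfl
    have h2 : partialSum a (j.val + 1) = partialSum b (j.val + 1) := hj
    rw [partialSum_succ, partialSum_succ] at h2
    omega
  -- Otherwise `a` is constant from `j` to `k`, so `a (j+1) = a j > b j ≥ b (j+1)`, and equal sums
  -- through `j` would break majorization at the next one.
  have hafter : ∀ k, j < k → a k < a j := by
    intro k hk
    refine lt_of_le_of_ne (ha hk.le) fun h => ?_
    have hk1 : j.val + 1 < n := by have := Fin.lt_def.1 hk; omega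
    set m : Fin n := ⟨j.val + 1, hk1⟩ with hm
    have h1 : a k ≤ a m := ha (Fin.le_def.2 hk)
    have h2 : b m ≤ b j := hb (Fin.le_def.2 (by simp [hm]))
    have h3 := hle (m.val + 1) m.2
    rw [partialSum_succ a m, partialSum_succ b m] at h3
    have h4 : partialSum a m.val = partialSum b m.val := hj
    omega
  refine ⟨i, j, hij', hilt, hjlt, ?_, ?_⟩
  · intro k l hkl
    have h1 := ha hkl
    have h2 : j < l → a l < a j := hafter l
    have h3 : k < i → a i + 1 ≤ a k := fun h => by
      have := hb h.le
      have := hmin k h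
      omega
    unfold unitTransfer
    rw [Fin.le_def] at hkl
    rw [Fin.lt_def] at h2 h3 hij'
    simp only [Fin.ext_iff]
    have e1 : ∀ u w : Fin n, u.val = w.val → a u = a w := fun u w h => by rw [Fin.ext h]
    have := e1 k i
    have := e1 k j
    have := e1 l i
    have := e1 l j
    split_ifs <;> omega
  · intro k hk
    rw [partialSum_unitTransfer a hij' (by omega) k hk]
    have := hle k hk
    split_ifs with h
    · exact hstrict k h.1 h.2
    · exact this

/-- The total deficit, with truncated subtraction, is the measure for the induction on transfers. -/
theorem sum_tsub_unitTransfer_lt {a b : Fin n → ℕ} {i j : Fin n} (hi : a i < b i)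
    (hj : b j < a j) :
    ∑ k, (b k - unitTransfer a i j k) < ∑ k, (b k - a k) := by
  refine Finset.sum_lt_sum (fun k _ => ?_) ⟨i, Finset.mem_univ i, by simp [unitTransfer]; omega⟩
  unfold unitTransfer
  split_ifs with h1 h2
  · omega
  · subst h2; omega
  · exact le_rfl

end Majorization

/-! ### Transfers realized by cone trees -/

section ConeTree

variable {n t : ℕ}

theorem isCyclicGraph_zero_iff {V : Type*} [Finite V] {G : SimpleGraph V} :
    IsCyclicGraph 0 G ↔ G.IsTree := by
  rw [SimpleGraph.isTree_iff_connected_and_card]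
  rfl

theorem lt_of_mem_coneClass {π : Fin n → ℕ} {G : SimpleGraph (Fin n)}
    (hG : G ∈ coneClass π t 0) (i : Fin n) : π i < n := by
  classical
  obtain ⟨-, -, v, hv⟩ := hG
  rw [← hv i]
  simpa using G.degree_lt_card_verts (v i)

theorem degree_top_eq {V : Type*} [Fintype V] (u : V)
    [Fintype ((⊤ : SimpleGraph V).neighborSet u)] :
    (⊤ : SimpleGraph V).degree u = Fintype.card V - 1 := by
  classical
  convert SimpleGraph.complete_graph_degree u

open Classical in
theorem degree_join_top_inl {H : SimpleGraph (Fin (n - t))} (htn : t + 2 ≤ n) (u : Fin t) :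
    (join (⊤ : SimpleGraph (Fin t)) H).degree (Sum.inl u) = n - 1 := by
  have hu := u.isLt
  rw [degree_join_inl, degree_top_eq, Fintype.card_fin, Fintype.card_fin]
  omega

theorem lt_apply_of_mem_coneClass {π : Fin n → ℕ} {G : SimpleGraph (Fin n)}
    (hG : G ∈ coneClass π t 0) (i : Fin n) : t < π i := by
  classical
  obtain ⟨⟨htn, H, hH, ⟨φ⟩⟩, -, v, hv⟩ := hG
  rw [← hv i, ← φ.degree_eq (v i)]
  rcases φ (v i) with u | w
  · rw [degree_join_top_inl htn]; omega
  · have : Nontrivial (Fin (n - t)) := Fin.nontrivial_iff_two_le.2 (by omega)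
    have := hH.1.preconnected.degree_pos_of_nontrivial w
    rw [degree_join_inr, Fintype.card_fin]
    omega

theorem exists_mem_coneClass_unitTransfer {α : ℝ} (hα : 0 ≤ α) {π : Fin n → ℕ}
    {G : SimpleGraph (Fin n)} (hG : G ∈ coneClass π t 0) {i j : Fin n} (hij : i < j)
    (hi : π i + 1 < n) (hj : t + 2 ≤ π j) (hanti : Antitone (unitTransfer π i j)) :
    ∃ G₁ ∈ coneClass (unitTransfer π i j) t 0,
      generalSpectralRadius G α < generalSpectralRadius G₁ α := by
  classical
  obtain ⟨⟨htn, H, hH, ⟨φ⟩⟩, hπ, v, hv⟩ := hG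
  rw [isCyclicGraph_zero_iff] at hH
  have hji : π j ≤ π i := hπ hij.le
  have hdeg : ∀ k, (join (⊤ : SimpleGraph (Fin t)) H).degree (φ (v k)) = π k := fun k => by
    rw [← hv k, φ.degree_eq]
  -- Cone vertices have degree `n - 1`, so a smaller degree places the vertex in the tree.
  have hinr : ∀ k, π k + 1 < n → ∃ w, φ (v k) = Sum.inr w ∧ π k = t + H.degree w := by
    intro k hk
    have h := hdeg k
    rcases hz : φ (v k) with u | w
    · rw [hz, degree_join_top_inl htn] at h
      omega
    · rw [hz, degree_join_inr, Fintype.card_fin] at h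
      exact ⟨w, rfl, h.symm⟩
  obtain ⟨p, hp, hpd⟩ := hinr i hi
  obtain ⟨q, hq, hqd⟩ := hinr j (by omega)
  have hpq : p ≠ q := by
    rintro rfl
    exact hij.ne (v.injective (φ.injective (hp.trans hq.symm)))
  obtain ⟨H', hH', hlt, hne, hcase⟩ := exists_isTree_generalSpectralRadius_join_lt
    (⊤ : SimpleGraph (Fin t)) hH hpq (by omega) (by omega) hα
  set J := join (⊤ : SimpleGraph (Fin t)) H' with hJ
  -- Pulling back along `φ` itself lets the old labelling `v` be reused.
  obtain ⟨G₁, ψ, hψφ⟩ : ∃ (G₁ : SimpleGraph (Fin n)) (ψ : G₁ ≃g J), ∀ u, ψ u = φ u :=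
    ⟨_, SimpleGraph.Iso.comap φ.toEquiv J, fun _ => rfl⟩
  have hψ : ∀ u, G₁.degree u = J.degree (φ u) := fun u => by rw [← hψφ, ψ.degree_eq]
  have hother : ∀ k, k ≠ i → k ≠ j → J.degree (φ (v k)) = π k := by
    intro k hki hkj
    rw [← hdeg k]
    rcases hz : φ (v k) with u | w
    · rw [hJ, degree_join_top_inl htn, degree_join_top_inl htn]
    · rw [hJ, degree_join_inr, degree_join_inr, hne w]
      · rintro rfl
        exact hki (v.injective (φ.injective (hz.trans hp.symm)))
      · rintro rfl
        exact hkj (v.injective (φ.injective (hz.trans hq.symm)))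
  have hJp : J.degree (φ (v i)) = t + H'.degree p := by
    rw [hp, hJ, degree_join_inr, Fintype.card_fin]
  have hJq : J.degree (φ (v j)) = t + H'.degree q := by
    rw [hq, hJ, degree_join_inr, Fintype.card_fin]
  refine ⟨G₁, ⟨⟨htn, H', isCyclicGraph_zero_iff.2 hH', ⟨ψ⟩⟩, hanti, ?_⟩, ?_⟩
  · rcases hcase with ⟨h1, h2⟩ | ⟨h1, h2⟩
    · refine ⟨v, fun k => ?_⟩
      rw [hψ]
      unfold unitTransfer
      split_ifs with hki hkj
      · subst hki; omega
      · subst hkj; omega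
      · exact hother k hki hkj
    -- Here `q` received the larger degree, so the labels `i` and `j` are exchanged.
    · refine ⟨(Equiv.swap i j).trans v, fun k => ?_⟩
      rw [hψ, Equiv.trans_apply]
      unfold unitTransfer
      split_ifs with hki hkj
      · subst hki; rw [Equiv.swap_apply_left]; omega
      · subst hkj; rw [Equiv.swap_apply_right]; omega
      · rw [Equiv.swap_apply_of_ne_of_ne hki hkj]; exact hother k hki hkj
  · rwa [generalSpectralRadius_congr φ, generalSpectralRadius_congr ψ]

/-- The general spectral radius of a cone tree can be increased strictly while passing to a degree
sequence that strictly majorizes the given one. -/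
theorem exists_mem_coneClass_of_majorized {α : ℝ} (hα : 0 ≤ α) {π' : Fin n → ℕ}
    (hπ' : Antitone π') (hupper : ∀ i, π' i < n) (hlower : ∀ i, t < π' i) (N : ℕ) :
    ∀ (π : Fin n → ℕ) (G : SimpleGraph (Fin n)), ∑ k, (π' k - π k) ≤ N → G ∈ coneClass π t 0 →
      (∀ k ≤ n, partialSum π k ≤ partialSum π' k) → partialSum π n = partialSum π' n → π ≠ π' →
      ∃ G₁ ∈ coneClass π' t 0, generalSpectralRadius G α < generalSpectralRadius G₁ α := by
  induction N with
  | zero =>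
    intro π G hN hG hle htot hne
    -- With zero deficit a transfer would have to lower it further, which is absurd.
    obtain ⟨i, j, -, hi, hj, -⟩ := exists_unitTransfer hG.2.1 hπ' hle htot hne
    have := sum_tsub_unitTransfer_lt hi hj
    omega
  | succ N ih =>
    intro π G hN hG hle htot hne
    obtain ⟨i, j, hij, hi, hj, hanti, hle'⟩ := exists_unitTransfer hG.2.1 hπ' hle htot hne
    have := sum_tsub_unitTransfer_lt hi hj
    have h1 := hupper i
    have h2 := hlower j
    obtain ⟨G₁, hG₁, hlt⟩ :=
      exists_mem_coneClass_unitTransfer hα hG hij (by omega) (by omega) hanti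
    by_cases heq : unitTransfer π i j = π'
    · exact ⟨G₁, heq ▸ hG₁, hlt⟩
    · obtain ⟨G₂, hG₂, hlt₂⟩ := ih _ G₁ (by omega) hG₁ hle' (by
        rw [partialSum_unitTransfer π hij (by omega) n le_rfl, if_neg (by omega), htot,
          add_zero]) heq
      exact ⟨G₂, hG₂, hlt.trans hlt₂⟩

end ConeTree

end ConeGraph

theorem theorem5p5 (n t : ℕ) (ht : t + 3 ≤ n) (α : ℝ) (hα : 0 ≤ α)
    (π π' : Fin n → ℕ)
    (hπ : ConeGraph.StrictlyMajorized (fun i => (π i : ℝ)) (fun i => (π' i : ℝ)))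
    (G G' : SimpleGraph (Fin n))
    (hG : ConeGraph.IsThetaMaximal α (ConeGraph.coneClass π t 0) G)
    (hG' : ConeGraph.IsThetaMaximal α (ConeGraph.coneClass π' t 0) G') :
    ConeGraph.generalSpectralRadius G α < ConeGraph.generalSpectralRadius G' α := by
  obtain ⟨⟨-, -, hle, htot⟩, hne⟩ := hπ
  have htot' : ConeGraph.partialSum π n = ConeGraph.partialSum π' n := by
    rw [ConeGraph.partialSum_card, ConeGraph.partialSum_card]
    beta_reduce at htot
    exact_mod_cast htot
  have hle' : ∀ k ≤ n, ConeGraph.partialSum π k ≤ ConeGraph.partialSum π' k := by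
    intro k hk
    -- Majorization only bounds `1 ≤ k < n`; the ends follow from empty sums and equal totals.
    rcases Nat.eq_zero_or_pos k with rfl | hk0
    · rw [ConeGraph.partialSum_zero, ConeGraph.partialSum_zero]
    rcases hk.eq_or_lt with rfl | hkn
    · exact htot'.le
    · unfold ConeGraph.partialSum
      have h := hle k hk0 hkn
      beta_reduce at h
      exact_mod_cast h
  obtain ⟨G₁, hG₁, hlt⟩ := ConeGraph.exists_mem_coneClass_of_majorized hα hG'.1.2.1
    (ConeGraph.lt_of_mem_coneClass hG'.1) (ConeGraph.lt_apply_of_mem_coneClass hG'.1) _ π G le_rfl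
    hG.1 hle' htot' (fun h => hne (by rw [h]))
  exact hlt.trans_le (hG'.2 G₁ hG₁)
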